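/- Let $d\ge 2$ and let $K_1,K_2\subset\mathbb R^d$ be nonempty compact convex sets, each of which is either a single point or has a smooth boundary whose sectional curvatures are all positive (for $d=2$: whose curvature as a plane curve is positive). Let $\mathfrak p:\mathbb R^d\to\mathbb T^d=\mathbb R^d/2\pi\mathbb Z^d$ be the projection onto the flat torus. For each $i\in\{1,2\}$ fix an orientation of $\partial K_i$, either by its outgoing or by its ingoing unit normal vector; a unit vector $\theta$ is said to be directly orthogonal to $\partial K_i$ at $x\in\partial K_i$ if it is the unit normal at $x$ giving this orientation (if $K_i$ is a point, every unit vector is directly orthogonal to it). Let $\mathcal P_{K_1,K_2}$ be the set of orthogeodesics from $K_1$ to $K_2$, that is, of the unit speed geodesic curves $\gamma:[0,\ell(\gamma)]\to\mathbb T^d$, of length $\ell(\gamma)>0$ and velocity $\theta\in\mathbb S^{d-1}$, such that $\gamma(0)=\mathfrak p(x_1)$ and $\gamma(\ell(\gamma))=\mathfrak p(x_2)$ for some $x_1\in\partial K_1$ and $x_2\in\partial K_2$ at which $\theta$ is directly orthogonal to $\partial K_1$ and $\partial K_2$, respectively. Then there is $T_0>0$ such that for every $T>T_0$ the set $\{\gamma\in\mathcal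 P_{K_1,K_2}: T_0<\ell(\gamma)\le T\}$ is finite and, as $T\to+\infty$, $$\sharp\{\gamma\in\mathcal P_{K_1,K_2}: T_0<\ell(\gamma)\le T\}=\frac{\pi^{d/2}\,T^d}{(2\pi)^d\,\Gamma\!\left(\frac d2+1\right)}+\mathcal O(T^{d-1}).$$ -/

import Mathlib

open scoped ContDiff

/-- Euclidean space `ℝᵈ`. -/
abbrev Euc (d : ℕ) : Type := EuclideanSpace ℝ (Fin d)

/-! ### The flat torus `ℝᵈ / 2πℤᵈ` -/

/-- The lattice `2πℤᵈ`. -/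
def torusLattice (d : ℕ) : AddSubgroup (Euc d) where
  carrier := {x | ∀ i, ∃ n : ℤ, x i = 2 * Real.pi * n}
  zero_mem' := fun _ => ⟨0, by simp⟩
  add_mem' := by
    intro x y hx hy i
    obtain ⟨m, hm⟩ := hx i
    obtain ⟨n, hn⟩ := hy i
    exact ⟨m + n, by rw [PiLp.add_apply, hm, hn]; push_cast; ring⟩
  neg_mem' := by
    intro x hx i
    obtain ⟨m, hm⟩ := hx i
    exact ⟨-m, by rw [PiLp.neg_apply, hm]; push_cast; ring⟩

/-- The torus `𝕋ᵈ = ℝᵈ / 2πℤᵈ`. -/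
abbrev FlatTorus (d : ℕ) : Type := Euc d ⧸ torusLattice d

/-- The canonical projection `𝔭 : ℝᵈ → 𝕋ᵈ`. -/
def torusProj (d : ℕ) (x : Euc d) : FlatTorus d := QuotientAddGroup.mk x

/-! ### Strictly convex compact sets with smooth boundary -/

/-- `f` is a smooth defining function of `K` in the open set `U`: it has no critical point in `U`
and `K` is the sublevel set `{f ≤ 0}` there. Then `∂K ∩ U = {f = 0} ∩ U` is a smooth hypersurface,
its tangent space at `x` is the kernel of `Df(x)`, and its outward unit normal is `∇f / |∇f|`. -/
structure IsLocalDefiningFunction {d : ℕ} (K U : Set (Euc d)) (f : Euc d → ℝ) : Prop where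
  isOpen : IsOpen U
  smooth : ContDiffOn ℝ ∞ f U
  regular : ∀ y ∈ U, fderiv ℝ f y ≠ 0
  sublevel : ∀ y ∈ U, (y ∈ K ↔ f y ≤ 0)

/-- The second fundamental form `⟨dn(u), v⟩ = D²f(x)(u, v) / |∇f(x)|`, for `u, v` in the kernel of
`Df(x)`, of the level set of `f` through `x`, where `n = ∇f / |∇f|`. (It is positive definite for a
round sphere with its outward normal.) -/
noncomputable def secondFundamentalForm {d : ℕ} (f : Euc d → ℝ) (x u v : Euc d) : ℝ :=
  fderiv ℝ (fderiv ℝ f) x u v / ‖fderiv ℝ f x‖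

/-- The sectional curvature at `x` of the level set of `f` through `x`, along the plane spanned by
two linearly independent tangent vectors `u, v` (Gauss equation in Euclidean space). -/
noncomputable def sectionalCurvature {d : ℕ} (f : Euc d → ℝ) (x u v : Euc d) : ℝ :=
  (secondFundamentalForm f x u u * secondFundamentalForm f x v v -
      secondFundamentalForm f x u v ^ 2) /
    (‖u‖ ^ 2 * ‖v‖ ^ 2 - inner ℝ u v ^ 2)

/-- The level set of `f` through `x` is positively curved at `x`: all its sectional curvatures are
positive. It is a curve if `d = 2`; then there are no sectional curvatures, and the condition is
that the curvature of the curve is positive. -/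
def IsPositivelyCurvedAt {d : ℕ} (f : Euc d → ℝ) (x : Euc d) : Prop :=
  (d = 2 → ∀ v, fderiv ℝ f x v = 0 → v ≠ 0 → 0 < secondFundamentalForm f x v v) ∧
  ∀ u v, fderiv ℝ f x u = 0 → fderiv ℝ f x v = 0 → LinearIndependent ℝ ![u, v] →
    0 < sectionalCurvature f x u v

/-- `∂K` is a smooth hypersurface, positively curved at each of its points. (The curvature of `∂K`
at `x` does not depend on the choice of the defining function near `x`.) -/
def HasSmoothPositivelyCurvedBoundary {d : ℕ} (K : Set (Euc d)) : Prop :=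
  ∀ x ∈ frontier K, ∃ (U : Set (Euc d)) (f : Euc d → ℝ),
    x ∈ U ∧ IsLocalDefiningFunction K U f ∧ IsPositivelyCurvedAt f x

/-- Nonempty compact convex sets which are strictly convex with smooth boundary in the sense of
positive curvature; a point is one of them by convention. -/
structure IsSmoothStrictlyConvex {d : ℕ} (K : Set (Euc d)) : Prop where
  nonempty : K.Nonempty
  isCompact : IsCompact K
  convex : Convex ℝ K
  boundary : (∃ x, K = {x}) ∨ HasSmoothPositivelyCurvedBoundary K

/-! ### Oriented normals -/

/-- `θ` is an outward unit normal vector to `K` at the boundary point `x`: a unit vector such that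
`K` lies in the half space `{y | ⟨y - x, θ⟩ ≤ 0}`. For a convex body with smooth boundary there is
exactly one at each boundary point; for a point, all unit vectors are outward normal. -/
def IsOutwardUnitNormal {d : ℕ} (K : Set (Euc d)) (x θ : Euc d) : Prop :=
  x ∈ frontier K ∧ ‖θ‖ = 1 ∧ ∀ y ∈ K, inner ℝ (y - x) θ ≤ 0

/-- The two ways of orienting `∂K` by a unit normal. -/
inductive NormalOrientation
  | outgoing
  | ingoing

/-- `θ` is directly orthogonal to `∂K` at `x`: it is the unit normal that gives the chosen
orientation. -/
def IsDirectlyOrthogonal {d : ℕ} (K : Set (Euc d)) :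
    NormalOrientation → Euc d → Euc d → Prop
  | .outgoing, x, θ => IsOutwardUnitNormal K x θ
  | .ingoing, x, θ => IsOutwardUnitNormal K x (-θ)

/-! ### Geodesic curves and orthogeodesics -/

/-- The curve `c : [0, ℓ] → 𝕋ᵈ` is a geodesic of unit speed and velocity `θ`: the projection of a
straight line with direction `θ`. (Tangent spaces of `𝕋ᵈ` are identified with `ℝᵈ` through the
differential of the projection.) -/
def IsGeodesicWithVelocity {d : ℕ} {ℓ : ℝ} (c : Set.Icc (0 : ℝ) ℓ → FlatTorus d) (θ : Euc d) :
    Prop :=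
  ‖θ‖ = 1 ∧ ∃ x : Euc d, ∀ t : Set.Icc (0 : ℝ) ℓ, c t = torusProj d (x + (t : ℝ) • θ)

/-- A (nontrivial) geodesic curve on the flat torus, parametrized by arc length. -/
structure GeodesicCurve (d : ℕ) where
  length : ℝ
  length_pos : 0 < length
  toFun : Set.Icc (0 : ℝ) length → FlatTorus d
  isGeodesic : ∃ θ, IsGeodesicWithVelocity toFun θ

/-- The starting point of a geodesic curve. -/
def GeodesicCurve.source {d : ℕ} (γ : GeodesicCurve d) : FlatTorus d :=
  γ.toFun ⟨0, le_rfl, γ.length_pos.le⟩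

/-- The end point of a geodesic curve. -/
def GeodesicCurve.target {d : ℕ} (γ : GeodesicCurve d) : FlatTorus d :=
  γ.toFun ⟨γ.length, γ.length_pos.le, le_rfl⟩

/-- The orthogeodesics from `K₁` to `K₂`: the geodesic curves that start on `𝔭(∂K₁)`, end on
`𝔭(∂K₂)`, and whose velocity is directly orthogonal to (a branch of) these immersed submanifolds at
the two end points, for the orientations `σ₁` and `σ₂`. -/
def orthogeodesics {d : ℕ} (K₁ : Set (Euc d)) (σ₁ : NormalOrientation)
    (K₂ : Set (Euc d)) (σ₂ : NormalOrientation) : Set (GeodesicCurve d) :=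
  {γ | ∃ θ, IsGeodesicWithVelocity γ.toFun θ ∧
    (∃ x₁, torusProj d x₁ = γ.source ∧ IsDirectlyOrthogonal K₁ σ₁ x₁ θ) ∧
    (∃ x₂, torusProj d x₂ = γ.target ∧ IsDirectlyOrthogonal K₂ σ₂ x₂ θ)}

/-! The count reduces to counting lattice points in a ball. Positive curvature makes each `K`
strongly convex: `c‖y - z‖² ≤ ⟨y - z, θ⟩` whenever `θ` is the outward normal at `y` and `z ∈ K`.
Adding this inequality at two boundary points shows that the inverse Gauss map `w`, sending a
direction to the point with that normal, is well defined, bounded and Lipschitz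
(`exists_gauss_inverse`).

An orthogeodesic with displacement `z = ℓθ` starts at `w₁ θ` modulo the lattice and must end at `w₂
θ`. Orthogeodesics thus correspond to the vectors `z ≠ 0` such that `z + (w₁ - w₂)(z/‖z‖)` lies in
`2πℤᵈ` (`mem_orthogeodesics_iff`). The perturbation is bounded by some `C`, and since `z ↦ z/‖z‖`
has small Lipschitz constant far from the origin, it is a contraction on `‖z‖ ≥ r`. There the map is
injective, and it reaches every lattice point of norm at least `r + C`.

The count up to `T` is therefore squeezed, up to a constant, between the numbers of lattice points
in the balls of radii `T - C` and `T + C`. Comparing volumes with cubes of side `2π` gives the main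
term, with an error of order `T ^ (d - 1)`. -/

/-! ### Quadratic forms and second order Taylor estimates -/

/-- A quadratic form that is positive on the kernel of a linear form becomes positive definite
after adding a multiple of the square of the linear form. -/
lemma exists_mul_sq_norm_le_add_sq {E : Type*} [NormedAddCommGroup E] [NormedSpace ℝ E]
    [FiniteDimensional ℝ E] (B : E →L[ℝ] E →L[ℝ] ℝ) (l : E →L[ℝ] ℝ)
    (h : ∀ v, l v = 0 → v ≠ 0 → 0 < B v v) :
    ∃ M m : ℝ, 0 ≤ M ∧ 0 < m ∧ ∀ v, m * ‖v‖ ^ 2 ≤ B v v + M * (l v) ^ 2 := by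
  have hcont (n : ℝ) : Continuous fun v : E => B v v + n * (l v) ^ 2 := by fun_prop
  have hS : IsCompact (Metric.sphere (0 : E) 1) := isCompact_sphere _ _
  -- These open sets increase with `n` and cover the unit sphere, so by compactness a single one
  -- contains it.
  obtain ⟨n, hn⟩ : ∃ n : ℕ, Metric.sphere (0 : E) 1 ⊆ {v | 0 < B v v + n * (l v) ^ 2} := by
    refine hS.elim_directed_cover (fun n : ℕ => {v : E | 0 < B v v + n * (l v) ^ 2})
      (fun n => isOpen_lt continuous_const (hcont n)) ?_ ?_
    · intro v hv
      have hv0 : v ≠ 0 := by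
        rintro rfl
        simp at hv
      simp only [Set.mem_iUnion, Set.mem_ofPred_eq]
      by_cases hl : l v = 0
      · exact ⟨0, by simpa using h v hl hv0⟩
      · have hl2 : 0 < (l v) ^ 2 := by positivity
        obtain ⟨n, hn⟩ := exists_nat_gt (-(B v v) / (l v) ^ 2)
        refine ⟨n, ?_⟩
        rw [div_lt_iff₀ hl2] at hn
        linarith
    · refine Monotone.directed_le (fun a b hab v hv => ?_)
      simp only [Set.mem_ofPred_eq] at hv ⊢
      have : (a : ℝ) * (l v) ^ 2 ≤ b * (l v) ^ 2 := by gcongr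
      linarith
  obtain ⟨m, hm, hmin⟩ : ∃ m : ℝ, 0 < m ∧
      ∀ v ∈ Metric.sphere (0 : E) 1, m ≤ B v v + n * (l v) ^ 2 := by
    rcases (Metric.sphere (0 : E) 1).eq_empty_or_nonempty with he | hne
    · exact ⟨1, one_pos, by simp [he]⟩
    · obtain ⟨v₀, hv₀, hv₀m⟩ := hS.exists_isMinOn hne (hcont n).continuousOn
      exact ⟨_, hn hv₀, fun v hv => hv₀m hv⟩
  refine ⟨n, m, n.cast_nonneg, hm, fun v => ?_⟩
  by_cases hv : v = 0
  · simp [hv]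
  have hv' : 0 < ‖v‖ := norm_pos_iff.2 hv
  have key := hmin (‖v‖⁻¹ • v) (by simp [norm_smul, hv'.ne'])
  simp only [map_smul, _root_.smul_apply, smul_eq_mul] at key
  calc m * ‖v‖ ^ 2 ≤ (‖v‖⁻¹ * (‖v‖⁻¹ * (B v) v) + n * (‖v‖⁻¹ * l v) ^ 2) * ‖v‖ ^ 2 := by gcongr
    _ = _ := by field_simp

/-- Second order Taylor inequality on `[0, 1]`. -/
lemma add_add_half_le_of_le_deriv2 {φ φ' φ'' : ℝ → ℝ} {c : ℝ}
    (h1 : ∀ t ∈ Set.Icc (0 : ℝ) 1, HasDerivAt φ (φ' t) t)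
    (h2 : ∀ t ∈ Set.Icc (0 : ℝ) 1, HasDerivAt φ' (φ'' t) t)
    (hc : ∀ t ∈ Set.Icc (0 : ℝ) 1, c ≤ φ'' t) : φ 0 + φ' 0 + c / 2 ≤ φ 1 := by
  have mono {g g' : ℝ → ℝ} (hg : ∀ t ∈ Set.Icc (0 : ℝ) 1, HasDerivAt g (g' t) t)
      (hn : ∀ t ∈ Set.Icc (0 : ℝ) 1, 0 ≤ g' t) : MonotoneOn g (Set.Icc 0 1) :=
    monotoneOn_of_deriv_nonneg (convex_Icc _ _)
      (fun t ht => (hg t ht).continuousAt.continuousWithinAt)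
      (fun t ht => (hg t (interior_subset ht)).differentiableAt.differentiableWithinAt)
      (fun t ht => by rw [(hg t (interior_subset ht)).deriv]; exact hn t (interior_subset ht))
  have m1 : MonotoneOn (fun t => φ' t - c * t) (Set.Icc 0 1) :=
    mono (g' := fun t => φ'' t - c * 1)
      (fun t ht => (h2 t ht).sub ((hasDerivAt_id' t).const_mul c))
      (fun t ht => by linarith [hc t ht])
  have m2 : MonotoneOn (fun t => φ t - φ' 0 * t - c / 2 * t ^ 2) (Set.Icc 0 1) := by
    refine mono (g' := fun t => φ' t - φ' 0 * 1 - c / 2 * (2 * t))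
      (fun t ht => ((h1 t ht).sub ((hasDerivAt_id' t).const_mul _)).sub ?_) (fun t ht => ?_)
    · simpa using (hasDerivAt_pow 2 t).const_mul (c / 2)
    · have := m1 (Set.left_mem_Icc.2 zero_le_one) ht ht.1
      simp only at this
      linarith
  have := m2 (Set.left_mem_Icc.2 zero_le_one) (Set.right_mem_Icc.2 zero_le_one) zero_le_one
  simp only at this
  linarith

/-- Second order Taylor inequality along a segment. -/
lemma taylor_two_le {E : Type*} [NormedAddCommGroup E] [NormedSpace ℝ E] {f : E → ℝ} {U : Set E}
    (hU : IsOpen U) (hf : ContDiffOn ℝ ∞ f U) {x v : E} {c : ℝ}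
    (hseg : ∀ t ∈ Set.Icc (0 : ℝ) 1, x + t • v ∈ U)
    (hc : ∀ t ∈ Set.Icc (0 : ℝ) 1, c ≤ fderiv ℝ (fderiv ℝ f) (x + t • v) v v) :
    f x + fderiv ℝ f x v + c / 2 ≤ f (x + v) := by
  have hline (t : ℝ) : HasDerivAt (fun t : ℝ => x + t • v) v t := by
    simpa using ((hasDerivAt_id' t).smul_const v).const_add x
  have hf' : ContDiffOn ℝ ∞ (fderiv ℝ f) U := hf.fderiv_of_isOpen hU (by simp)
  have h1 : ∀ t ∈ Set.Icc (0 : ℝ) 1,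
      HasDerivAt (fun t : ℝ => f (x + t • v)) (fderiv ℝ f (x + t • v) v) t := fun t ht =>
    (((hf.differentiableOn (by simp)).differentiableAt
      (hU.mem_nhds (hseg t ht))).hasFDerivAt).comp_hasDerivAt t (hline t)
  have h2 : ∀ t ∈ Set.Icc (0 : ℝ) 1,
      HasDerivAt (fun t : ℝ => fderiv ℝ f (x + t • v) v)
        (fderiv ℝ (fderiv ℝ f) (x + t • v) v v) t := fun t ht => by
    have := ((((hf'.differentiableOn (by simp)).differentiableAt
      (hU.mem_nhds (hseg t ht))).hasFDerivAt).comp_hasDerivAt t (hline t))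
    simpa using this.clm_apply (hasDerivAt_const t v)
  simpa using add_add_half_le_of_le_deriv2 h1 h2 hc

/-! ### Defining functions: normals, Hessian and local strong convexity -/

namespace IsLocalDefiningFunction

variable {d : ℕ} {K U : Set (Euc d)} {f : Euc d → ℝ} {x : Euc d}

lemma mem_interior_of_neg (h : IsLocalDefiningFunction K U f) (hx : x ∈ U) (hfx : f x < 0) :
    x ∈ interior K := by
  rw [mem_interior_iff_mem_nhds]
  filter_upwards [h.isOpen.mem_nhds hx,
    (h.smooth.continuousOn.continuousAt (h.isOpen.mem_nhds hx)).eventually_lt_const hfx]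
    with y hy hfy using (h.sublevel y hy).2 hfy.le

lemma eq_zero_of_mem_frontier (h : IsLocalDefiningFunction K U f) (hK : IsClosed K)
    (hx : x ∈ U) (hxK : x ∈ frontier K) : f x = 0 := by
  refine le_antisymm ((h.sublevel x hx).1 (hK.frontier_subset hxK)) ?_
  by_contra! hlt
  exact hxK.2 (h.mem_interior_of_neg hx hlt)

lemma continuousOn_fderiv (h : IsLocalDefiningFunction K U f) : ContinuousOn (fderiv ℝ f) U :=
  h.smooth.continuousOn_fderiv_of_isOpen h.isOpen (by simp)

lemma continuousOn_fderiv_fderiv (h : IsLocalDefiningFunction K U f) :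
    ContinuousOn (fderiv ℝ (fderiv ℝ f)) U :=
  (h.smooth.fderiv_of_isOpen (m := ∞) h.isOpen (by simp)).continuousOn_fderiv_of_isOpen
    h.isOpen (by simp)

/-- The Hessian of a defining function of a convex set is nonnegative on tangent vectors. -/
lemma hessian_nonneg (h : IsLocalDefiningFunction K U f) (hK : IsClosed K) (hconv : Convex ℝ K)
    (hx : x ∈ U) (hxK : x ∈ frontier K) {u : Euc d} (hu : fderiv ℝ f x u = 0) :
    0 ≤ fderiv ℝ (fderiv ℝ f) x u u := by
  by_contra! hneg
  set a := fderiv ℝ (fderiv ℝ f) x u u with ha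
  have hcont : ContinuousAt (fun y => fderiv ℝ (fderiv ℝ f) y u u) x :=
    ((h.continuousOn_fderiv_fderiv.continuousAt (h.isOpen.mem_nhds hx)).clm_apply
      continuousAt_const).clm_apply continuousAt_const
  have hev : ∀ᶠ y in nhds x, y ∈ U ∧ fderiv ℝ (fderiv ℝ f) y u u < a / 2 :=
    (h.isOpen.eventually_mem hx).and (hcont.eventually_lt_const (by linarith))
  obtain ⟨r, hr, hball⟩ := Metric.eventually_nhds_iff_ball.1 hev
  have hs : ∃ s : ℝ, 0 < s ∧ s * ‖u‖ < r := by
    refine ⟨r / (‖u‖ + 1) , by positivity, ?_⟩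
    rw [div_mul_eq_mul_div, div_lt_iff₀ (by positivity)]
    nlinarith [norm_nonneg u]
  obtain ⟨s, hs, hsr⟩ := hs
  -- A negative second derivative gives `f (x ± s • u) ≤ s ^ 2 * a / 4 < 0`. Both points are then
  -- interior to `K`, hence so is their midpoint `x`, which is absurd.
  have hint (σ : ℝ) (hσ : |σ| = s) : x + σ • u ∈ interior K := by
    have hσ2 : σ ^ 2 = s ^ 2 := by rw [← hσ, sq_abs]
    have hmem : ∀ t ∈ Set.Icc (0 : ℝ) 1, x + t • σ • u ∈ Metric.ball x r := by
      intro t ht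
      rw [mem_ball_iff_norm, add_sub_cancel_left, norm_smul, norm_smul, Real.norm_eq_abs,
        Real.norm_eq_abs, hσ, abs_of_nonneg ht.1]
      have : 0 ≤ s * ‖u‖ := by positivity
      nlinarith [ht.2]
    have key := taylor_two_le (f := fun y => -f y) (x := x) (v := σ • u) (c := -(s ^ 2 * (a / 2)))
      h.isOpen h.smooth.neg (fun t ht => (hball _ (hmem t ht)).1) (fun t ht => by
        have := (hball _ (hmem t ht)).2
        have hd : fderiv ℝ (fun y => -f y) = -fderiv ℝ f := funext fun y => fderiv_fun_neg
        rw [hd, fderiv_neg]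
        simp only [map_smul, _root_.smul_apply, smul_eq_mul,
          _root_.neg_apply]
        nlinarith [sq_nonneg s])
    rw [fderiv_fun_neg] at key
    simp only [map_smul, _root_.neg_apply, hu,
      h.eq_zero_of_mem_frontier hK hx hxK] at key
    refine h.mem_interior_of_neg (by simpa using (hball _ (hmem 1 (by simp))).1) ?_
    have : 0 < s ^ 2 * (-a) := mul_pos (by positivity) (by linarith)
    simp at key
    nlinarith
  refine hxK.2 ?_
  have := hconv.interior (hint s (abs_of_pos hs)) (hint (-s) (by rw [abs_neg, abs_of_pos hs]))
    (by norm_num : (0 : ℝ) ≤ 1 / 2) (by norm_num : (0 : ℝ) ≤ 1 / 2) (by norm_num)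
  convert this using 1
  module

/-- At an outward normal `θ`, the differential of a defining function is a multiple of `θ`. -/
lemma fderiv_eq_of_isOutwardUnitNormal (h : IsLocalDefiningFunction K U f) (hK : IsClosed K)
    (hx : x ∈ U) {θ : Euc d} (hθ : IsOutwardUnitNormal K x θ) (v : Euc d) :
    fderiv ℝ f x v = ‖fderiv ℝ f x‖ * inner ℝ v θ := by
  set g := (InnerProductSpace.toDual ℝ (Euc d)).symm (fderiv ℝ f x) with hg
  have hgv (v) : inner ℝ g v = fderiv ℝ f x v := InnerProductSpace.toDual_symm_apply
  have hng : ‖g‖ = ‖fderiv ℝ f x‖ := LinearIsometryEquiv.norm_map _ _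
  obtain ⟨hxK, hθ1, hsup⟩ := hθ
  -- A direction along which `f` decreases enters `K`, so it cannot point to the positive side of
  -- the supporting hyperplane.
  have hneg (v : Euc d) (hv : fderiv ℝ f x v < 0) : inner ℝ v θ ≤ 0 := by
    have hd : HasDerivAt (fun t : ℝ => f (x + t • v)) (fderiv ℝ f x v) 0 := by
      have hline : HasDerivAt (fun t : ℝ => x + t • v) v 0 := by
        simpa using ((hasDerivAt_id' (0 : ℝ)).smul_const v).const_add x
      have hfd : HasFDerivAt f (fderiv ℝ f x) (x + (0 : ℝ) • v) := by
        simpa using ((h.smooth.differentiableOn (by simp)).differentiableAt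
          (h.isOpen.mem_nhds hx)).hasFDerivAt
      exact hfd.comp_hasDerivAt 0 hline
    have hU : ∀ᶠ t : ℝ in nhdsWithin 0 (Set.Ioi 0), x + t • v ∈ U := by
      have : Filter.Tendsto (fun t : ℝ => x + t • v) (nhdsWithin 0 (Set.Ioi 0)) (nhds x) := by
        have hc : Continuous fun t : ℝ => x + t • v := by fun_prop
        simpa using (hc.tendsto 0).mono_left nhdsWithin_le_nhds
      exact this (h.isOpen.mem_nhds hx)
    have hslope := ((hasDerivWithinAt_iff_tendsto_slope' (by simp)).1
      (hd.hasDerivWithinAt (s := Set.Ioi 0))).eventually_lt_const hv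
    obtain ⟨t, ht, htU, htp⟩ := (hslope.and (hU.and self_mem_nhdsWithin)).exists
    have htp : 0 < t := htp
    have hft : f (x + t • v) ≤ 0 := by
      simp only [slope_def_field, zero_smul, add_zero, sub_zero,
        h.eq_zero_of_mem_frontier hK hx hxK] at ht
      by_contra! hpos
      exact absurd (div_pos hpos htp) ht.not_gt
    have := hsup _ ((h.sublevel _ htU).2 hft)
    rw [add_sub_cancel_left, real_inner_smul_left] at this
    by_contra! hc
    exact absurd (mul_pos htp hc) this.not_gt
  -- Equality in Cauchy–Schwarz forces `g` to be a nonnegative multiple of `θ`. If it failed, `‖g‖ •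
  -- θ - g` would be a direction of decrease of `f` with positive component along `θ`.
  have heq : inner ℝ g θ = ‖g‖ * ‖θ‖ := by
    refine le_antisymm (real_inner_le_norm _ _) ?_
    by_contra! hlt
    rw [hθ1, mul_one] at hlt
    have hg0 : 0 < ‖g‖ := by
      rw [hng]; exact norm_pos_iff.2 (h.regular x hx)
    have h1 := hneg (‖g‖ • θ - g) (by
      rw [← hgv, inner_sub_right, real_inner_smul_right, real_inner_self_eq_norm_sq]
      nlinarith)
    rw [inner_sub_left, real_inner_smul_left, real_inner_self_eq_norm_sq, hθ1] at h1
    linarith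
  rw [inner_eq_norm_mul_iff_real, hθ1, one_smul] at heq
  rw [← hgv, ← hng, real_inner_comm θ v, ← real_inner_smul_left, ← heq]

end IsLocalDefiningFunction

lemma eventually_abs_hessian_sub_le {E : Type*} [NormedAddCommGroup E] [NormedSpace ℝ E]
    {f : E → ℝ} {U : Set E} (hU : IsOpen U) (hf : ContDiffOn ℝ ∞ f U) {x : E} (hx : x ∈ U)
    {ε : ℝ} (hε : 0 < ε) :
    ∀ᶠ y in nhds x, ∀ v,
      |fderiv ℝ (fderiv ℝ f) y v v - fderiv ℝ (fderiv ℝ f) x v v| ≤ ε * ‖v‖ * ‖v‖ := by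
  have hc : ContinuousAt (fderiv ℝ (fderiv ℝ f)) x :=
    ((hf.fderiv_of_isOpen (m := ∞) hU (by simp)).continuousOn_fderiv_of_isOpen hU
      (by simp)).continuousAt (hU.mem_nhds hx)
  filter_upwards [(Metric.tendsto_nhds (α := E →L[ℝ] E →L[ℝ] ℝ)).1 hc ε hε] with y hy v
  have hy' : ‖fderiv ℝ (fderiv ℝ f) y - fderiv ℝ (fderiv ℝ f) x‖ ≤ ε :=
    (dist_eq_norm (fderiv ℝ (fderiv ℝ f) y) (fderiv ℝ (fderiv ℝ f) x)).symm.trans_le hy.le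
  exact (ContinuousLinearMap.le_opNorm₂ (fderiv ℝ (fderiv ℝ f) y - fderiv ℝ (fderiv ℝ f) x)
    v v).trans (by gcongr)

namespace IsLocalDefiningFunction

variable {d : ℕ} {K U : Set (Euc d)} {f : Euc d → ℝ} {x : Euc d}

/-- Positive curvature of the boundary of a convex set means that the Hessian of a defining
function is positive definite on the tangent space. -/
lemma hessian_pos (hd : 2 ≤ d) (h : IsLocalDefiningFunction K U f) (hK : IsClosed K)
    (hconv : Convex ℝ K) (hx : x ∈ U) (hxK : x ∈ frontier K) (hpos : IsPositivelyCurvedAt f x)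
    {u : Euc d} (hu : fderiv ℝ f x u = 0) (hu0 : u ≠ 0) :
    0 < fderiv ℝ (fderiv ℝ f) x u u := by
  have hg0 : 0 < ‖fderiv ℝ f x‖ := norm_pos_iff.2 (h.regular x hx)
  rcases hd.eq_or_lt with rfl | hd3
  · have := hpos.1 rfl u hu hu0
    rwa [secondFundamentalForm, div_pos_iff_of_pos_right hg0] at this
  -- For `d ≥ 3` the tangent space has dimension at least 2. If the form vanished at `(u, u)`, the
  -- numerator of the curvature of a tangent plane through `u` would be `-II(u, v)² ≤ 0`.
  refine lt_of_le_of_ne (h.hessian_nonneg hK hconv hx hxK hu) fun h0 => ?_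
  have hrank : 1 < Module.finrank ℝ (LinearMap.ker (fderiv ℝ f x).toLinearMap) := by
    have h1 := (fderiv ℝ f x).toLinearMap.finrank_range_add_finrank_ker
    have h2 := Submodule.finrank_le (LinearMap.range (fderiv ℝ f x).toLinearMap)
    simp only [finrank_euclideanSpace, Fintype.card_fin, Module.finrank_self] at h1 h2
    omega
  obtain ⟨v, hv⟩ := exists_linearIndependent_pair_of_one_lt_finrank hrank
    (x := ⟨u, hu⟩) (fun h => hu0 (congrArg Subtype.val h))
  have hli : LinearIndependent ℝ ![u, (v : Euc d)] := by
    have := hv.map' (LinearMap.ker (fderiv ℝ f x).toLinearMap).subtype (Submodule.ker_subtype _)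
    have e : ![u, (v : Euc d)] =
        (LinearMap.ker (fderiv ℝ f x).toLinearMap).subtype ∘ ![⟨u, hu⟩, v] := by
      ext i
      fin_cases i <;> rfl
    rw [e]
    exact this
  have hsec := hpos.2 u v hu v.2 hli
  refine absurd hsec (not_lt.2 ?_)
  refine div_nonpos_of_nonpos_of_nonneg ?_ ?_
  · simp only [secondFundamentalForm, ← h0, zero_div, zero_mul, zero_sub]
    exact neg_nonpos.2 (sq_nonneg _)
  · have := sq_le_sq' (neg_le_of_abs_le (abs_real_inner_le_norm u (v : Euc d)))
      (le_of_abs_le (abs_real_inner_le_norm u (v : Euc d)))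
    rw [mul_pow] at this
    linarith

/-- Local strong convexity, in terms of the differential of a defining function. -/
lemma exists_forall_sq_norm_le_fderiv (h : IsLocalDefiningFunction K U f) (hK : IsClosed K)
    (hx : x ∈ U)
    (hpos : ∀ u, fderiv ℝ f x u = 0 → u ≠ 0 → 0 < fderiv ℝ (fderiv ℝ f) x u u) :
    ∃ r c : ℝ, 0 < r ∧ 0 < c ∧ Metric.ball x r ⊆ U ∧
      ∀ y ∈ Metric.ball x r, y ∈ frontier K → ∀ z ∈ Metric.ball x r, z ∈ K →
      c * ‖y - z‖ ^ 2 ≤ fderiv ℝ f y (y - z) := by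
  obtain ⟨M, m, hM, hm, hq⟩ := exists_mul_sq_norm_le_add_sq _ _ hpos
  set G := ‖fderiv ℝ f x‖ + 1 with hG
  have hGpos : 0 < G := by positivity
  -- `ε` bounds the variation of `Df` near `x`; its smallness lets `M * ε ^ 2 * ‖v‖ ^ 2` be absorbed
  -- by the Hessian term.
  obtain ⟨ε, hε, hε1, hεM⟩ : ∃ ε : ℝ, 0 < ε ∧ ε ≤ 1 ∧ M * ε ^ 2 ≤ m / 8 := by
    refine ⟨min 1 (m / (8 * (M + 1))), by positivity, min_le_left _ _, ?_⟩
    set e := min 1 (m / (8 * (M + 1)))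
    have h0 : 0 ≤ e := by positivity
    have h1 : e ≤ 1 := min_le_left _ _
    have h2 : e ≤ m / (8 * (M + 1)) := min_le_right _ _
    rw [le_div_iff₀ (by positivity)] at h2
    nlinarith [mul_nonneg hM h0]
  have c1 := h.continuousOn_fderiv.continuousAt (h.isOpen.mem_nhds hx)
  have hev : ∀ᶠ y in nhds x, y ∈ U ∧ dist (fderiv ℝ f y) (fderiv ℝ f x) < ε ∧
      ∀ v, |fderiv ℝ (fderiv ℝ f) y v v - fderiv ℝ (fderiv ℝ f) x v v| ≤ m / 4 * ‖v‖ * ‖v‖ :=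
    (h.isOpen.eventually_mem hx).and ((Metric.tendsto_nhds.1 c1 ε hε).and
      (eventually_abs_hessian_sub_le h.isOpen h.smooth hx (by positivity)))
  obtain ⟨r₀, hr₀, hball⟩ := Metric.eventually_nhds_iff_ball.1 hev
  -- The second bound gives `M * G * ‖v‖ ≤ 1` for `v = z - y`, so that the quadratic term `M * a ^
  -- 2` is at most `|a|`.
  set r := min r₀ (1 / (2 * G * (M + 1))) with hr
  have hrpos : 0 < r := by positivity
  refine ⟨r, m / 16, hrpos, by positivity, fun y hy => (hball y ?_).1, ?_⟩
  · exact Metric.ball_subset_ball (min_le_left _ _) hy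
  intro y hy hyK z hz hzK
  have hsub : Metric.ball x r ⊆ Metric.ball x r₀ := Metric.ball_subset_ball (min_le_left _ _)
  have hseg : ∀ t ∈ Set.Icc (0 : ℝ) 1, y + t • (z - y) ∈ Metric.ball x r₀ := fun t ht =>
    hsub ((convex_ball x r).add_smul_sub_mem hy hz ht)
  set v := z - y with hv
  have hvr : ‖v‖ ≤ 1 / (G * (M + 1)) := by
    rw [mem_ball_iff_norm] at hy hz
    have h1 : v = (z - x) - (y - x) := by rw [hv]; abel
    have h2 : r ≤ 1 / (2 * G * (M + 1)) := min_le_right _ _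
    calc ‖v‖ ≤ ‖z - x‖ + ‖y - x‖ := by rw [h1]; exact norm_sub_le _ _
      _ ≤ 1 / (2 * G * (M + 1)) + 1 / (2 * G * (M + 1)) := by linarith
      _ = _ := by field_simp; norm_num
  have key := taylor_two_le (v := v) (c := 3 / 4 * m * ‖v‖ ^ 2 - M * (fderiv ℝ f x v) ^ 2)
    h.isOpen h.smooth (fun t ht => (hball _ (hseg t ht)).1) (fun t ht => by
      have h1 := neg_le_of_abs_le ((hball _ (hseg t ht)).2.2 v)
      have h2 := hq v
      nlinarith)
  have hyz : y + v = z := by rw [hv]; abel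
  rw [hyz, h.eq_zero_of_mem_frontier hK (hball y (hsub hy)).1 hyK] at key
  have hfz := (h.sublevel z (hball z (hsub hz)).1).1 hzK
  have hyv : y - z = -v := by rw [hv]; abel
  rw [hyv, norm_neg, map_neg]
  set a := fderiv ℝ f y v with ha
  set b := fderiv ℝ f x v with hb
  have hab : |a - b| ≤ ε * ‖v‖ := by
    have h1 := (hball y (hsub hy)).2.1
    rw [dist_eq_norm] at h1
    have := (fderiv ℝ f y - fderiv ℝ f x).le_of_opNorm_le h1.le v
    simpa using this
  have haG : |a| ≤ G * ‖v‖ := by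
    have hb1 : |b| ≤ ‖fderiv ℝ f x‖ * ‖v‖ := (fderiv ℝ f x).le_opNorm v
    have h1 := abs_add_le (a - b) b
    rw [sub_add_cancel] at h1
    nlinarith [norm_nonneg v]
  have hb2 : b ^ 2 ≤ 2 * a ^ 2 + 2 * (ε ^ 2 * ‖v‖ ^ 2) := by
    have h1 : (a - b) ^ 2 ≤ (ε * ‖v‖) ^ 2 := sq_le_sq' (neg_le_of_abs_le hab) (le_of_abs_le hab)
    nlinarith [sq_nonneg (a + (a - b))]
  have hMa : M * a ^ 2 ≤ |a| := by
    rw [le_div_iff₀ (by positivity)] at hvr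
    have h1 : M * |a| ≤ 1 := by
      have : M * |a| ≤ M * (G * ‖v‖) := by gcongr
      nlinarith [mul_nonneg hGpos.le (norm_nonneg v)]
    rw [← sq_abs]
    nlinarith [abs_nonneg a]
  have hMb : M * b ^ 2 ≤ 2 * |a| + m / 4 * ‖v‖ ^ 2 := by
    have h1 : M * b ^ 2 ≤ M * (2 * a ^ 2 + 2 * (ε ^ 2 * ‖v‖ ^ 2)) := by gcongr
    have h2 : M * ε ^ 2 * ‖v‖ ^ 2 ≤ m / 8 * ‖v‖ ^ 2 := by gcongr
    nlinarith
  rcases eq_or_ne v 0 with hv0 | hv0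
  · simp [ha, hv0]
  have hv2 : 0 < m * ‖v‖ ^ 2 := by positivity
  -- Since `f y = 0` and `f z ≤ 0`, the Taylor bound now reads `a + m / 4 * ‖v‖ ^ 2 ≤ |a|`. This
  -- excludes `a ≥ 0`, and for `a < 0` it yields `m / 8 * ‖v‖ ^ 2 ≤ -a`.
  rcases abs_cases a with ⟨h1, h2⟩ | ⟨h1, h2⟩ <;> nlinarith

end IsLocalDefiningFunction

/-! ### Global strong convexity and the inverse Gauss map -/

section StrongConvexity

variable {d : ℕ} {K : Set (Euc d)}

/-- Strong convexity near a boundary point, in terms of outward normals. -/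
lemma HasSmoothPositivelyCurvedBoundary.exists_local_sq_norm_le_inner (hd : 2 ≤ d)
    (hK : IsClosed K) (hconv : Convex ℝ K) (hb : HasSmoothPositivelyCurvedBoundary K)
    {x : Euc d} (hx : x ∈ frontier K) :
    ∃ r c : ℝ, 0 < r ∧ 0 < c ∧ ∀ y ∈ Metric.ball x r, ∀ θ, IsOutwardUnitNormal K y θ →
      ∀ z ∈ Metric.ball x r, z ∈ K → c * ‖y - z‖ ^ 2 ≤ inner ℝ (y - z) θ := by
  obtain ⟨U, f, hxU, hf, hpos⟩ := hb x hx
  obtain ⟨r, c, hr, hc, hrU, H⟩ := hf.exists_forall_sq_norm_le_fderiv hK hxU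
    fun u hu hu0 => hf.hessian_pos hd hK hconv hxU hx hpos hu hu0
  have c1 := (hf.continuousOn_fderiv.continuousAt (hf.isOpen.mem_nhds hxU)).norm
  obtain ⟨r', hr', hball⟩ := Metric.eventually_nhds_iff_ball.1
    (c1.eventually_lt_const (lt_add_one ‖fderiv ℝ f x‖))
  refine ⟨min r r', c / (‖fderiv ℝ f x‖ + 1), by positivity, by positivity, ?_⟩
  intro y hy θ hθ z hz hzK
  have hyr := Metric.ball_subset_ball (min_le_left r r') hy
  have h1 := H y hyr hθ.1 z (Metric.ball_subset_ball (min_le_left r r') hz) hzK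
  rw [hf.fderiv_eq_of_isOutwardUnitNormal hK (hrU hyr) hθ] at h1
  have h2 := hball y (Metric.ball_subset_ball (min_le_right r r') hy)
  have h3 : 0 ≤ inner ℝ (y - z) θ := by
    have := hθ.2.2 z hzK
    rw [← neg_sub, inner_neg_left] at this
    linarith
  rw [div_mul_eq_mul_div, div_le_iff₀ (by positivity)]
  nlinarith

/-- Strong convexity of a compact convex set with smooth positively curved boundary. -/
lemma HasSmoothPositivelyCurvedBoundary.exists_sq_norm_le_inner (hd : 2 ≤ d)
    (hK : IsCompact K) (hconv : Convex ℝ K) (hb : HasSmoothPositivelyCurvedBoundary K) :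
    ∃ c : ℝ, 0 < c ∧ ∀ y θ, IsOutwardUnitNormal K y θ →
      ∀ z ∈ K, c * ‖y - z‖ ^ 2 ≤ inner ℝ (y - z) θ := by
  choose! r c hr hc H using fun x hx =>
    hb.exists_local_sq_norm_le_inner hd hK.isClosed hconv (x := x) hx
  have hF : IsCompact (frontier K) := hK.of_isClosed_subset isClosed_frontier
    hK.isClosed.frontier_subset
  -- Balls of half radius: a point `y` in one of them can be moved by less than `r x / 2` without
  -- leaving the ball where the local estimate holds.
  obtain ⟨t, htc⟩ := hF.elim_nhds_subcover' (fun x _ => Metric.ball x (r x / 2))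
    (fun x hx => Metric.ball_mem_nhds x (half_pos (hr x hx)))
  obtain ⟨R, hR⟩ := hK.isBounded.exists_norm_le
  have hfin {g : Euc d → ℝ} (hg : ∀ x ∈ frontier K, 0 < g x) :
      ∃ e : ℝ, 0 < e ∧ ∀ x ∈ t, e ≤ g x := by
    rcases t.eq_empty_or_nonempty with he | hne
    · exact ⟨1, one_pos, by simp [he]⟩
    · obtain ⟨x₀, hx₀, hmin⟩ := t.exists_min_image (fun x => g x) hne
      exact ⟨g x₀, hg x₀ x₀.2, hmin⟩
  obtain ⟨δ, hδ, hδr⟩ := hfin (g := fun x => r x / 2) fun x hx => half_pos (hr x hx)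
  obtain ⟨c₀, hc₀, hcc⟩ := hfin hc
  have hR0 : 0 < 2 * |R| + δ := by positivity
  -- The factor `s = δ / (2 * |R| + δ)` brings `z` within `δ` of `y`. The left side of the estimate
  -- scales by `s ^ 2` and the right side by `s`, so one factor `s` remains.
  refine ⟨c₀ * (δ / (2 * |R| + δ)), by positivity, fun y θ hθ z hz => ?_⟩
  have hyK := hK.isClosed.frontier_subset hθ.1
  have hyz : ‖y - z‖ ≤ 2 * |R| := by
    have := norm_sub_le y z
    linarith [hR y hyK, hR z hz, le_abs_self R]
  -- move `z` towards `y` so that it comes into the range of the local estimate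
  set s := δ / (2 * |R| + δ) with hs
  have hs0 : 0 < s := by positivity
  have hs1 : s ≤ 1 := by
    rw [hs, div_le_one hR0]
    linarith [abs_nonneg R]
  obtain ⟨x, hxt, hyx⟩ : ∃ x ∈ t, y ∈ Metric.ball (x : Euc d) (r x / 2) := by
    obtain ⟨x, hx, hy⟩ := Set.mem_iUnion₂.1 (htc hθ.1)
    exact ⟨x, hx, hy⟩
  have hzK : y + s • (z - y) ∈ K := hconv.add_smul_sub_mem hyK hz ⟨hs0.le, hs1⟩
  have hsz : ‖s • (z - y)‖ < δ := by
    rw [norm_smul, Real.norm_of_nonneg hs0.le, norm_sub_rev, hs, div_mul_eq_mul_div,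
      div_lt_iff₀ hR0]
    nlinarith
  have hzx : y + s • (z - y) ∈ Metric.ball (x : Euc d) (r x) := by
    rw [mem_ball_iff_norm] at hyx ⊢
    have h1 : y + s • (z - y) - x = (y - x) + s • (z - y) := by abel
    rw [h1]
    have := norm_add_le (y - x) (s • (z - y))
    linarith [hδr x hxt]
  have key := H x x.2 y (Metric.ball_subset_ball (by linarith [hr x x.2]) hyx) θ hθ _ hzx hzK
  have h2 : y - (y + s • (z - y)) = s • (y - z) := by module
  rw [h2, norm_smul, Real.norm_of_nonneg hs0.le, real_inner_smul_left] at key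
  have h3 : c₀ * (s * ‖y - z‖) ^ 2 ≤ c x * (s * ‖y - z‖) ^ 2 := by
    gcongr
    exact hcc x hxt
  have h4 : s * (c₀ * s * ‖y - z‖ ^ 2) ≤ s * inner ℝ (y - z) θ := by nlinarith
  exact le_of_mul_le_mul_left h4 hs0

/-- A maximizer over `K` of the linear form `⟨·, θ⟩` works: it is not interior, since moving along
`θ` would increase the form. -/
lemma exists_isOutwardUnitNormal (hK : IsCompact K) (hne : K.Nonempty) {θ : Euc d}
    (hθ : ‖θ‖ = 1) : ∃ x, IsOutwardUnitNormal K x θ := by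
  obtain ⟨x, hx, hmax⟩ := hK.exists_isMaxOn hne
    (f := fun y => inner ℝ y θ) (by fun_prop : Continuous fun y : Euc d => inner ℝ y θ).continuousOn
  have hmax' : ∀ y ∈ K, inner ℝ (y - x) θ ≤ 0 := fun y hy => by
    rw [inner_sub_left]
    have : inner ℝ y θ ≤ inner ℝ x θ := hmax hy
    linarith
  refine ⟨x, ⟨subset_closure hx, fun hint => ?_⟩, hθ, hmax'⟩
  have hc : Continuous fun t : ℝ => x + t • θ := by fun_prop
  have hev : ∀ᶠ t : ℝ in nhds 0, x + t • θ ∈ K := by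
    have := hc.tendsto 0
    simp only [zero_smul, add_zero] at this
    exact this (mem_interior_iff_mem_nhds.1 hint)
  obtain ⟨t, ht, htp⟩ := ((hev.filter_mono nhdsWithin_le_nhds).and
    (self_mem_nhdsWithin : Set.Ioi (0 : ℝ) ∈ nhdsWithin 0 (Set.Ioi 0))).exists
  have htp : 0 < t := htp
  have := hmax' _ ht
  rw [add_sub_cancel_left, real_inner_smul_left, real_inner_self_eq_norm_sq, hθ] at this
  linarith

/-- The inverse of the Gauss map is well defined, Lipschitz and bounded. -/
lemma IsSmoothStrictlyConvex.exists_gauss_inverse (hd : 2 ≤ d) (hK : IsSmoothStrictlyConvex K) :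
    ∃ (w : Euc d → Euc d) (L C : ℝ), 0 ≤ L ∧ 0 ≤ C ∧
      (∀ x θ, IsOutwardUnitNormal K x θ ↔ ‖θ‖ = 1 ∧ x = w θ) ∧
      (∀ θ, ‖θ‖ = 1 → ‖w θ‖ ≤ C) ∧
      ∀ θ θ', ‖θ‖ = 1 → ‖θ'‖ = 1 → ‖w θ - w θ'‖ ≤ L * ‖θ - θ'‖ := by
  choose! w hw using fun θ => exists_isOutwardUnitNormal hK.isCompact hK.nonempty (θ := θ)
  obtain ⟨R, hR⟩ := hK.isCompact.isBounded.exists_norm_le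
  have hmem {x θ} (h : IsOutwardUnitNormal K x θ) : x ∈ K :=
    hK.isCompact.isClosed.frontier_subset h.1
  obtain ⟨c, hc, H⟩ : ∃ c : ℝ, 0 < c ∧ ∀ y θ, IsOutwardUnitNormal K y θ →
      ∀ z ∈ K, c * ‖y - z‖ ^ 2 ≤ inner ℝ (y - z) θ := by
    rcases hK.boundary with ⟨x, rfl⟩ | hb
    · refine ⟨1, one_pos, fun y θ hy z hz => ?_⟩
      have h1 : y = x := hmem hy
      have h2 : z = x := hz
      simp [h1, h2]
    · exact hb.exists_sq_norm_le_inner hd hK.isCompact hK.convex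
  -- Adding the strong convexity inequalities at `x` and `x'` gives `2c‖x - x'‖² ≤ ⟨x - x', θ -
  -- θ'⟩`. The case `θ = θ'` is the uniqueness of the point with a given normal.
  have lip {x θ x' θ'} (h : IsOutwardUnitNormal K x θ) (h' : IsOutwardUnitNormal K x' θ') :
      ‖x - x'‖ ≤ 1 / (2 * c) * ‖θ - θ'‖ := by
    have h1 := H x θ h x' (hmem h')
    have h2 := H x' θ' h' x (hmem h)
    have h3 : inner ℝ (x - x') (θ - θ') = inner ℝ (x - x') θ + inner ℝ (x' - x) θ' := by
      rw [inner_sub_right, ← neg_sub x x', inner_neg_left]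
      ring
    have h4 := real_inner_le_norm (x - x') (θ - θ')
    rw [norm_sub_rev x' x] at h2
    rw [div_mul_eq_mul_div, one_mul, le_div_iff₀ (by positivity)]
    rcases (norm_nonneg (x - x')).eq_or_lt with h0 | h0
    · rw [← h0]
      simp
    · refine le_of_mul_le_mul_left ?_ h0
      nlinarith
  refine ⟨w, 1 / (2 * c), |R|, by positivity, by positivity, fun x θ => ⟨fun h => ⟨h.2.1, ?_⟩, ?_⟩,
    fun θ hθ => (hR _ (hmem (hw θ hθ))).trans (le_abs_self _),
    fun θ θ' hθ hθ' => lip (hw θ hθ) (hw θ' hθ')⟩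
  · have := lip h (hw θ h.2.1)
    rw [sub_self, norm_zero, mul_zero] at this
    exact sub_eq_zero.1 (norm_le_zero_iff.1 this)
  · rintro ⟨hθ, rfl⟩
    exact hw θ hθ

/-- The ingoing orientation replaces `w` by `θ ↦ w (-θ)`, which keeps the same constants because `θ
↦ -θ` is an isometry of the sphere. -/
lemma IsSmoothStrictlyConvex.exists_directlyOrthogonal_iff (hd : 2 ≤ d)
    (hK : IsSmoothStrictlyConvex K) (σ : NormalOrientation) :
    ∃ (w : Euc d → Euc d) (L C : ℝ), 0 ≤ L ∧ 0 ≤ C ∧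
      (∀ x θ, IsDirectlyOrthogonal K σ x θ ↔ ‖θ‖ = 1 ∧ x = w θ) ∧
      (∀ θ, ‖θ‖ = 1 → ‖w θ‖ ≤ C) ∧
      ∀ θ θ', ‖θ‖ = 1 → ‖θ'‖ = 1 → ‖w θ - w θ'‖ ≤ L * ‖θ - θ'‖ := by
  obtain ⟨w, L, C, hL, hC, h1, h2, h3⟩ := hK.exists_gauss_inverse hd
  cases σ with
  | outgoing => exact ⟨w, L, C, hL, hC, h1, h2, h3⟩
  | ingoing =>
    refine ⟨fun θ => w (-θ), L, C, hL, hC, fun x θ => ?_, fun θ hθ => h2 _ (by simpa using hθ),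
      fun θ θ' hθ hθ' => ?_⟩
    · simpa [IsDirectlyOrthogonal] using h1 x (-θ)
    · have := h3 (-θ) (-θ') (by simpa using hθ) (by simpa using hθ')
      rwa [← neg_sub', norm_neg] at this

end StrongConvexity

/-! ### Perturbations of the identity by a function of the direction -/

section RadialPerturbation

variable {E : Type*} [NormedAddCommGroup E] [NormedSpace ℝ E]

lemma norm_normalize_sub_normalize_le {r : ℝ} (hr : 0 < r) {z z' : E} (hz : r ≤ ‖z‖)
    (hz' : r ≤ ‖z'‖) : ‖‖z‖⁻¹ • z - ‖z'‖⁻¹ • z'‖ ≤ 2 / r * ‖z - z'‖ := by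
  have h0 : 0 < ‖z‖ := hr.trans_le hz
  have h0' : 0 < ‖z'‖ := hr.trans_le hz'
  have e : ‖z‖⁻¹ • z - ‖z'‖⁻¹ • z' = ‖z‖⁻¹ • (z - z') + (‖z‖⁻¹ - ‖z'‖⁻¹) • z' := by module
  have h1 : ‖(‖z‖⁻¹ - ‖z'‖⁻¹) • z'‖ ≤ ‖z‖⁻¹ * ‖z - z'‖ := by
    have : ‖z‖⁻¹ - ‖z'‖⁻¹ = ‖z‖⁻¹ * ‖z'‖⁻¹ * (‖z'‖ - ‖z‖) := by field_simp
    rw [norm_smul, this, norm_mul, Real.norm_of_nonneg (by positivity), Real.norm_eq_abs,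
      abs_sub_comm]
    calc ‖z‖⁻¹ * ‖z'‖⁻¹ * |‖z‖ - ‖z'‖| * ‖z'‖ = ‖z‖⁻¹ * |‖z‖ - ‖z'‖| := by field_simp
      _ ≤ _ := by gcongr; exact abs_norm_sub_norm_le z z'
  calc ‖‖z‖⁻¹ • z - ‖z'‖⁻¹ • z'‖ ≤ ‖z‖⁻¹ * ‖z - z'‖ + ‖z‖⁻¹ * ‖z - z'‖ := by
        rw [e]
        refine (norm_add_le _ _).trans (add_le_add ?_ h1)
        rw [norm_smul, norm_inv, norm_norm]
    _ = 2 * ‖z‖⁻¹ * ‖z - z'‖ := by ring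
    _ ≤ _ := by
        rw [div_eq_mul_inv]
        gcongr

variable {w : E → E} {L C r : ℝ}
  (hL : 0 ≤ L) (hC : ∀ θ, ‖θ‖ = 1 → ‖w θ‖ ≤ C)
  (hw : ∀ θ θ', ‖θ‖ = 1 → ‖θ'‖ = 1 → ‖w θ - w θ'‖ ≤ L * ‖θ - θ'‖)
  (hr : 0 < r) (hLr : 4 * L ≤ r)

include hL hw hr hLr in
-- Normalization is `2 / r`-Lipschitz outside the ball of radius `r`, and `4 * L ≤ r` makes `L * (2
-- / r)` at most `1 / 2`.
lemma norm_radial_sub_le {z z' : E} (hz : r ≤ ‖z‖) (hz' : r ≤ ‖z'‖) :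
    ‖w (‖z‖⁻¹ • z) - w (‖z'‖⁻¹ • z')‖ ≤ 1 / 2 * ‖z - z'‖ := by
  have h0 : ‖z‖ ≠ 0 := (hr.trans_le hz).ne'
  have h0' : ‖z'‖ ≠ 0 := (hr.trans_le hz').ne'
  calc _ ≤ L * ‖‖z‖⁻¹ • z - ‖z'‖⁻¹ • z'‖ := hw _ _ (by simp [norm_smul, h0])
        (by simp [norm_smul, h0'])
    _ ≤ L * (2 / r * ‖z - z'‖) := by gcongr; exact norm_normalize_sub_normalize_le hr hz hz'
    _ = (2 * L / r) * ‖z - z'‖ := by ring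
    _ ≤ _ := by
        refine mul_le_mul_of_nonneg_right ?_ (norm_nonneg _)
        rw [div_le_iff₀ hr]
        linarith

include hL hw hr hLr in
/-- A bounded Lipschitz function of the direction is a contractive perturbation of the identity
far from the origin: injectivity. -/
lemma eq_of_add_radial_eq {z z' : E} (hz : r ≤ ‖z‖) (hz' : r ≤ ‖z'‖)
    (h : z + w (‖z‖⁻¹ • z) = z' + w (‖z'‖⁻¹ • z')) : z = z' := by
  have h1 := norm_radial_sub_le hL hw hr hLr hz hz'
  have h2 : w (‖z‖⁻¹ • z) - w (‖z'‖⁻¹ • z') = -(z - z') := by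
    rw [neg_sub, sub_eq_sub_iff_add_eq_add, add_comm, h, add_comm]
  rw [h2, norm_neg] at h1
  have : ‖z - z'‖ ≤ 0 := by linarith
  exact sub_eq_zero.1 (norm_le_zero_iff.1 this)

include hL hC hw hr hLr in
/-- A bounded Lipschitz function of the direction is a contractive perturbation of the identity
far from the origin: surjectivity. -/
lemma exists_add_radial_eq [CompleteSpace E] {y : E} (hC0 : 0 ≤ C) (hy : r + C ≤ ‖y‖) :
    ∃ z : E, ‖z - y‖ ≤ C ∧ z + w (‖z‖⁻¹ • z) = y := by
  -- Solutions are the fixed points of `F`, a contraction of the closed ball of radius `C` around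
  -- `y`. The assumption `r + C ≤ ‖y‖` keeps this ball in the region `r ≤ ‖z‖`.
  set F : E → E := fun z => y - w (‖z‖⁻¹ • z) with hF
  have hball {z : E} (hz : z ∈ Metric.closedBall y C) : r ≤ ‖z‖ := by
    rw [mem_closedBall_iff_norm, norm_sub_rev] at hz
    have := norm_sub_norm_le y z
    linarith
  have hmaps : Set.MapsTo F (Metric.closedBall y C) (Metric.closedBall y C) := by
    intro z hz
    have h0 : ‖z‖ ≠ 0 := (hr.trans_le (hball hz)).ne'
    rw [mem_closedBall_iff_norm, hF]
    simp only [sub_sub_cancel_left, norm_neg]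
    exact hC _ (by simp [norm_smul, h0])
  have hcontr : ContractingWith (1 / 2 : NNReal) (hmaps.restrict F _ _) := by
    refine ⟨by rw [div_lt_one (by norm_num)]; norm_num, LipschitzWith.of_dist_le_mul fun a b => ?_⟩
    have := norm_radial_sub_le hL hw hr hLr (hball a.2) (hball b.2)
    rw [Subtype.dist_eq, Subtype.dist_eq, dist_eq_norm, dist_eq_norm]
    simp only [Set.MapsTo.val_restrict_apply, hF, sub_sub_sub_cancel_left]
    rw [norm_sub_rev]
    simpa using this
  obtain ⟨z, hz, hfix, -⟩ := hcontr.exists_fixedPoint' Metric.isClosed_closedBall.isComplete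
    hmaps (Metric.mem_closedBall_self hC0) (edist_ne_top _ _)
  refine ⟨z, by rwa [← mem_closedBall_iff_norm], ?_⟩
  have : y - w (‖z‖⁻¹ • z) = z := hfix
  exact (sub_eq_iff_eq_add.1 this).symm

end RadialPerturbation

/-! ### Lattice points in balls, by comparison of volumes -/

section LatticeCount

open MeasureTheory

variable {d : ℕ}

/-- The points of `2πℤᵈ` in a closed ball. -/
def latticeBall (d : ℕ) (R : ℝ) : Set (Euc d) := {x | x ∈ torusLattice d ∧ ‖x‖ ≤ R}

/-- The half-open cube of side `2π` with lower corner `x`. -/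
def latticeCell (x : Euc d) : Set (Euc d) := {y | ∀ i, x i ≤ y i ∧ y i < x i + 2 * Real.pi}

lemma finite_latticeBall (d : ℕ) (R : ℝ) : (latticeBall d R).Finite := by
  set N : ℤ := ⌈R / (2 * Real.pi)⌉
  refine ((Set.finite_Icc (fun _ : Fin d => -N) (fun _ => N)).image
    (fun k => (WithLp.toLp 2 fun i => 2 * Real.pi * (k i : ℝ) : Euc d))).subset ?_
  rintro x ⟨hx, hxR⟩
  choose k hk using hx
  have hkN (i) : |(k i : ℝ)| ≤ N := by
    have h1 : ‖x i‖ ≤ R := (PiLp.norm_apply_le x i).trans hxR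
    rw [hk, Real.norm_eq_abs, abs_mul, abs_of_pos Real.two_pi_pos, mul_comm,
      ← le_div_iff₀ Real.two_pi_pos] at h1
    exact h1.trans (Int.le_ceil _)
  refine ⟨k, ⟨fun i => ?_, fun i => ?_⟩, ?_⟩
  · exact_mod_cast neg_le_of_abs_le (hkN i)
  · exact_mod_cast le_of_abs_le (hkN i)
  · ext i
    exact (hk i).symm

lemma latticeCell_eq_preimage (x : Euc d) :
    latticeCell x = (WithLp.ofLp : Euc d → (Fin d → ℝ)) ⁻¹'
      Set.univ.pi fun i => Set.Ico (x i) (x i + 2 * Real.pi) := by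
  ext y
  simp [latticeCell]

lemma measurableSet_latticeCell (x : Euc d) : MeasurableSet (latticeCell x) := by
  rw [latticeCell_eq_preimage]
  exact (PiLp.volume_preserving_ofLp (Fin d)).measurable
    (MeasurableSet.univ_pi fun i => measurableSet_Ico)

lemma volume_latticeCell (x : Euc d) :
    volume (latticeCell x) = ENNReal.ofReal ((2 * Real.pi) ^ d) := by
  rw [latticeCell_eq_preimage, (PiLp.volume_preserving_ofLp (Fin d)).measure_preimage
    (MeasurableSet.univ_pi fun i => measurableSet_Ico).nullMeasurableSet, Real.volume_pi_Ico]
  simp [ENNReal.ofReal_pow Real.two_pi_pos.le]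

lemma eq_of_mem_latticeCell {x x' y : Euc d} (hx : x ∈ torusLattice d) (hx' : x' ∈ torusLattice d)
    (h : y ∈ latticeCell x) (h' : y ∈ latticeCell x') : x = x' := by
  ext i
  obtain ⟨m, hm⟩ := hx i
  obtain ⟨n, hn⟩ := hx' i
  obtain ⟨h1, h2⟩ := h i
  obtain ⟨h3, h4⟩ := h' i
  rw [hm] at h1 h2 ⊢
  rw [hn] at h3 h4 ⊢
  have hp := Real.two_pi_pos
  have a1 : (m : ℝ) < n + 1 := by
    refine lt_of_mul_lt_mul_left ?_ hp.le
    linarith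
  have a2 : (n : ℝ) < m + 1 := by
    refine lt_of_mul_lt_mul_left ?_ hp.le
    linarith
  have a1' : m < n + 1 := by exact_mod_cast a1
  have a2' : n < m + 1 := by exact_mod_cast a2
  rw [show m = n by omega]

/-- The bound is the diagonal `2π√d` of a cell, by which the radius shifts in both volume
comparisons. -/
lemma norm_sub_le_of_mem_latticeCell {x y : Euc d} (h : y ∈ latticeCell x) :
    ‖y - x‖ ≤ √(d * (2 * Real.pi) ^ 2) := by
  rw [EuclideanSpace.norm_eq]
  refine Real.sqrt_le_sqrt ?_
  calc ∑ i, ‖(y - x) i‖ ^ 2 ≤ ∑ _i : Fin d, (2 * Real.pi) ^ 2 := by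
        refine Finset.sum_le_sum fun i _ => ?_
        obtain ⟨h1, h2⟩ := h i
        gcongr
        rw [PiLp.sub_apply, Real.norm_of_nonneg (by linarith)]
        linarith
    _ = _ := by simp

lemma exists_mem_latticeCell (y : Euc d) : ∃ x ∈ torusLattice d, y ∈ latticeCell x := by
  refine ⟨WithLp.toLp 2 fun i => 2 * Real.pi * (⌊y i / (2 * Real.pi)⌋ : ℝ),
    fun i => ⟨_, rfl⟩, fun i => ?_⟩
  have hp := Real.two_pi_pos
  have h1 := Int.floor_le (y i / (2 * Real.pi))
  have h2 := Int.lt_floor_add_one (y i / (2 * Real.pi))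
  rw [le_div_iff₀ hp] at h1
  rw [div_lt_iff₀ hp] at h2
  constructor <;> simp only <;> linarith

lemma volume_biUnion_latticeCell (R : ℝ) :
    volume (⋃ x ∈ (finite_latticeBall d R).toFinset, latticeCell x) =
      ENNReal.ofReal ((latticeBall d R).ncard * (2 * Real.pi) ^ d) := by
  rw [measure_biUnion_finset]
  · simp only [volume_latticeCell, Finset.sum_const, nsmul_eq_mul,
      ← Set.ncard_eq_toFinset_card _ (finite_latticeBall d R)]
    rw [ENNReal.ofReal_mul (Nat.cast_nonneg _), ENNReal.ofReal_natCast]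
  · intro x hx x' hx' hne
    simp only [Set.Finite.coe_toFinset] at hx hx'
    exact Set.disjoint_left.2 fun y hy hy' => hne (eq_of_mem_latticeCell hx.1 hx'.1 hy hy')
  · exact fun x _ => measurableSet_latticeCell x

/-- The volume of the unit ball of `ℝᵈ`. -/
noncomputable def unitBallVolume (d : ℕ) : ℝ := √Real.pi ^ d / Real.Gamma (d / 2 + 1)

lemma unitBallVolume_pos (d : ℕ) : 0 < unitBallVolume d :=
  div_pos (by have := Real.pi_pos; positivity) (Real.Gamma_pos_of_pos (by positivity))

lemma volume_closedBall_zero (hd : d ≠ 0) {R : ℝ} (hR : 0 ≤ R) :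
    volume (Metric.closedBall (0 : Euc d) R) = ENNReal.ofReal (unitBallVolume d * R ^ d) := by
  have : Nonempty (Fin d) := ⟨⟨0, Nat.pos_of_ne_zero hd⟩⟩
  rw [EuclideanSpace.volume_closedBall, Fintype.card_fin, ← ENNReal.ofReal_pow hR, mul_comm,
    ENNReal.ofReal_mul (unitBallVolume_pos d).le, unitBallVolume]

/-- Upper bound for the number of lattice points in a ball. -/
lemma ncard_latticeBall_mul_le (hd : d ≠ 0) {R : ℝ} (hR : 0 ≤ R) :
    (latticeBall d R).ncard * (2 * Real.pi) ^ d ≤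
      unitBallVolume d * (R + √(d * (2 * Real.pi) ^ 2)) ^ d := by
  have hV := unitBallVolume_pos d
  rw [← ENNReal.ofReal_le_ofReal_iff (by positivity), ← volume_biUnion_latticeCell,
    ← volume_closedBall_zero hd (by positivity)]
  refine measure_mono (Set.iUnion₂_subset fun x hx y hy => ?_)
  have hx : x ∈ latticeBall d R := by simpa using hx
  rw [mem_closedBall_zero_iff]
  have := norm_add_le x (y - x)
  rw [add_sub_cancel] at this
  linarith [hx.2, norm_sub_le_of_mem_latticeCell hy]

/-- Lower bound for the number of lattice points in a ball. -/
lemma le_ncard_latticeBall_mul (hd : d ≠ 0) {R : ℝ} (hR : √(d * (2 * Real.pi) ^ 2) ≤ R) :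
    unitBallVolume d * (R - √(d * (2 * Real.pi) ^ 2)) ^ d ≤
      (latticeBall d R).ncard * (2 * Real.pi) ^ d := by
  have hp := Real.two_pi_pos
  rw [← ENNReal.ofReal_le_ofReal_iff (by positivity), ← volume_biUnion_latticeCell,
    ← volume_closedBall_zero hd (by linarith)]
  refine measure_mono fun y hy => ?_
  obtain ⟨x, hx, hyx⟩ := exists_mem_latticeCell y
  rw [mem_closedBall_zero_iff] at hy
  refine Set.mem_iUnion₂.2 ⟨x, ?_, hyx⟩
  rw [Set.Finite.mem_toFinset]
  refine ⟨hx, ?_⟩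
  have := norm_sub_le y (y - x)
  rw [sub_sub_cancel] at this
  linarith [norm_sub_le_of_mem_latticeCell hyx]

end LatticeCount

/-! ### From orthogeodesics to lattice points -/

section OrthogeodesicCount

variable {d : ℕ}

lemma torusProj_eq_iff {x y : Euc d} :
    torusProj d x = torusProj d y ↔ y - x ∈ torusLattice d := by
  rw [torusProj, torusProj, QuotientAddGroup.eq, neg_add_eq_sub]

/-- The projection of a segment. -/
def straightCurve (x θ : Euc d) (hθ : ‖θ‖ = 1) (ℓ : ℝ) (hℓ : 0 < ℓ) : GeodesicCurve d :=
  ⟨ℓ, hℓ, fun t => torusProj d (x + (t : ℝ) • θ), θ, hθ, x, fun _ => rfl⟩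

/-- Two lifts of the starting point differ by a lattice vector, and translating the whole line by it
does not change its projection. -/
lemma GeodesicCurve.eq_straightCurve {γ : GeodesicCurve d} {x θ : Euc d}
    (h : IsGeodesicWithVelocity γ.toFun θ) (hx : torusProj d x = γ.source) :
    γ = straightCurve x θ h.1 γ.length γ.length_pos := by
  obtain ⟨ℓ, hℓ, c, hc⟩ := γ
  obtain ⟨hθ, y, hy⟩ := h
  simp only [GeodesicCurve.source] at hx hy
  rw [hy, torusProj_eq_iff] at hx
  simp only [straightCurve, GeodesicCurve.mk.injEq, heq_eq_eq, true_and]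
  funext t
  rw [hy, eq_comm, torusProj_eq_iff]
  simpa using hx

/-- A curve determines its velocity because the lattice is discrete: `t • (θ' - θ)` is a lattice
vector for every `t` in `[0, ℓ]`, and for small `t > 0` its coordinates are less than `2π` in
absolute value. -/
lemma straightCurve_inj {x x' θ θ' : Euc d} {hθ : ‖θ‖ = 1} {hθ' : ‖θ'‖ = 1} {ℓ ℓ' : ℝ}
    {hℓ : 0 < ℓ} {hℓ' : 0 < ℓ'} (h : straightCurve x θ hθ ℓ hℓ = straightCurve x' θ' hθ' ℓ' hℓ') :
    ℓ = ℓ' ∧ θ = θ' := by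
  obtain rfl : ℓ = ℓ' := congrArg GeodesicCurve.length h
  refine ⟨rfl, ?_⟩
  simp only [straightCurve, GeodesicCurve.mk.injEq, heq_eq_eq, true_and] at h
  have hmem (t : ℝ) (ht : t ∈ Set.Icc 0 ℓ) : t • (θ' - θ) ∈ torusLattice d := by
    have h0 := torusProj_eq_iff.1 (congrFun h ⟨0, le_rfl, hℓ.le⟩)
    have h1 := torusProj_eq_iff.1 (congrFun h ⟨t, ht⟩)
    have := (torusLattice d).sub_mem h1 h0
    convert this using 1
    module
  ext i
  set δ := θ' i - θ i with hδ
  obtain ⟨t, ht0, htℓ, htδ⟩ : ∃ t : ℝ, 0 < t ∧ t ≤ ℓ ∧ t * |δ| < 2 * Real.pi := by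
    have hp := Real.two_pi_pos
    refine ⟨min ℓ (2 * Real.pi / (|δ| + 1)), by positivity, min_le_left _ _, ?_⟩
    calc min ℓ (2 * Real.pi / (|δ| + 1)) * |δ| ≤ 2 * Real.pi / (|δ| + 1) * |δ| := by
          gcongr
          exact min_le_right _ _
      _ < 2 * Real.pi := by
          rw [div_mul_eq_mul_div, div_lt_iff₀ (by positivity)]
          linarith
  obtain ⟨n, hn⟩ := hmem t ⟨ht0.le, htℓ⟩ i
  have hn' : t * δ = 2 * Real.pi * n := by simpa [hδ] using hn
  have hn1 : |(n : ℝ)| < 1 := by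
    have : 2 * Real.pi * |(n : ℝ)| = t * |δ| := by
      rw [← abs_of_pos Real.two_pi_pos, ← abs_mul, ← hn', abs_mul, abs_of_pos ht0]
    refine lt_of_mul_lt_mul_left ?_ Real.two_pi_pos.le
    linarith
  have hn0 : n = 0 := Int.abs_lt_one_iff.1 (by exact_mod_cast hn1)
  rw [hn0, Int.cast_zero, mul_zero] at hn'
  have : δ = 0 := (mul_eq_zero.1 hn').resolve_left ht0.ne'
  linarith

lemma norm_normalize {z : Euc d} (hz : z ≠ 0) : ‖‖z‖⁻¹ • z‖ = 1 := by
  simp [norm_smul, hz]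

/-- The geodesic with displacement vector `z` and origin given by a function of the direction. -/
noncomputable def radialCurve (w : Euc d → Euc d) (z : Euc d) (hz : z ≠ 0) : GeodesicCurve d :=
  straightCurve (w (‖z‖⁻¹ • z)) (‖z‖⁻¹ • z) (norm_normalize hz) ‖z‖ (norm_pos_iff.2 hz)

lemma radialCurve_inj {w : Euc d → Euc d} {z z' : Euc d} {hz : z ≠ 0} {hz' : z' ≠ 0}
    (h : radialCurve w z hz = radialCurve w z' hz') : z = z' := by
  obtain ⟨h1, h2⟩ := straightCurve_inj h
  rw [← h1] at h2
  exact smul_right_injective _ (inv_ne_zero (norm_ne_zero_iff.2 hz)) h2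

variable {K₁ K₂ : Set (Euc d)} {σ₁ σ₂ : NormalOrientation} {w₁ w₂ : Euc d → Euc d}

/-- The vector `z` is the displacement `ℓθ`. The direction fixes both feet `w₁ θ` and `w₂ θ`, so the
only remaining condition is that `w₁ θ + z` and `w₂ θ` agree modulo the lattice. -/
lemma mem_orthogeodesics_iff
    (h₁ : ∀ x θ, IsDirectlyOrthogonal K₁ σ₁ x θ ↔ ‖θ‖ = 1 ∧ x = w₁ θ)
    (h₂ : ∀ x θ, IsDirectlyOrthogonal K₂ σ₂ x θ ↔ ‖θ‖ = 1 ∧ x = w₂ θ) {γ : GeodesicCurve d} :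
    γ ∈ orthogeodesics K₁ σ₁ K₂ σ₂ ↔ ∃ (z : Euc d) (hz : z ≠ 0), γ = radialCurve w₁ z hz ∧
      z + (w₁ (‖z‖⁻¹ • z) - w₂ (‖z‖⁻¹ • z)) ∈ torusLattice d := by
  constructor
  · rintro ⟨θ, hθ, ⟨x₁, hx₁, ho₁⟩, ⟨x₂, hx₂, ho₂⟩⟩
    obtain ⟨-, rfl⟩ := (h₁ _ _).1 ho₁
    obtain ⟨-, rfl⟩ := (h₂ _ _).1 ho₂
    have hγ := GeodesicCurve.eq_straightCurve hθ hx₁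
    set ℓ := γ.length with hℓ
    have hℓ0 : 0 < ℓ := γ.length_pos
    have hnorm : ‖ℓ • θ‖ = ℓ := by rw [norm_smul, Real.norm_of_nonneg hℓ0.le, hθ.1, mul_one]
    have hdir : ‖ℓ • θ‖⁻¹ • ℓ • θ = θ := by rw [hnorm, inv_smul_smul₀ hℓ0.ne']
    refine ⟨ℓ • θ, fun h0 => ?_, ?_, ?_⟩
    · rw [h0, norm_zero] at hnorm
      exact hℓ0.ne hnorm
    -- `straightCurve` carries proofs about its direction and length; making both variables allows
    -- substitution.
    · have hcongr {θ' : Euc d} {ℓ' : ℝ} (hθ' : ‖θ'‖ = 1) (hℓ' : 0 < ℓ') (e1 : θ' = θ)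
          (e2 : ℓ' = ℓ) : γ = straightCurve (w₁ θ') θ' hθ' ℓ' hℓ' := by
        subst e1 e2
        exact hγ
      exact hcongr _ _ hdir hnorm
    · rw [hdir]
      rw [hγ] at hx₂
      have : w₁ θ + ℓ • θ - w₂ θ ∈ torusLattice d := torusProj_eq_iff.1 hx₂
      convert this using 1
      abel
  · rintro ⟨z, hz, rfl, hΛ⟩
    have hθ := norm_normalize hz
    refine ⟨‖z‖⁻¹ • z, ⟨hθ, _, fun _ => rfl⟩, ⟨w₁ (‖z‖⁻¹ • z), ?_, (h₁ _ _).2 ⟨hθ, rfl⟩⟩,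
      ⟨w₂ (‖z‖⁻¹ • z), ?_, (h₂ _ _).2 ⟨hθ, rfl⟩⟩⟩
    · refine torusProj_eq_iff.2 ?_
      simp
    · refine torusProj_eq_iff.2 ?_
      convert hΛ using 1
      simp only [radialCurve, straightCurve]
      rw [smul_inv_smul₀ (norm_ne_zero_iff.2 hz)]
      abel

/-- Orthogeodesics are counted by lattice points, up to a bounded perturbation. -/
lemma finite_and_ncard_orthogeodesics
    (h₁ : ∀ x θ, IsDirectlyOrthogonal K₁ σ₁ x θ ↔ ‖θ‖ = 1 ∧ x = w₁ θ)
    (h₂ : ∀ x θ, IsDirectlyOrthogonal K₂ σ₂ x θ ↔ ‖θ‖ = 1 ∧ x = w₂ θ)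
    {L C r : ℝ} (hL : 0 ≤ L) (hC0 : 0 ≤ C) (hC : ∀ θ, ‖θ‖ = 1 → ‖w₁ θ - w₂ θ‖ ≤ C)
    (hw : ∀ θ θ', ‖θ‖ = 1 → ‖θ'‖ = 1 → ‖(w₁ θ - w₂ θ) - (w₁ θ' - w₂ θ')‖ ≤ L * ‖θ - θ'‖)
    (hr : 0 < r) (hLr : 4 * L ≤ r) (T : ℝ) :
    {γ ∈ orthogeodesics K₁ σ₁ K₂ σ₂ | r < γ.length ∧ γ.length ≤ T}.Finite ∧
    (latticeBall d (T - C)).ncard ≤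
      {γ ∈ orthogeodesics K₁ σ₁ K₂ σ₂ | r < γ.length ∧ γ.length ≤ T}.ncard +
        (latticeBall d (r + C)).ncard ∧
    {γ ∈ orthogeodesics K₁ σ₁ K₂ σ₂ | r < γ.length ∧ γ.length ≤ T}.ncard ≤
      (latticeBall d (T + C)).ncard := by
  set S := {γ ∈ orthogeodesics K₁ σ₁ K₂ σ₂ | r < γ.length ∧ γ.length ≤ T} with hS
  set w : Euc d → Euc d := fun θ => w₁ θ - w₂ θ with hwdef
  have hmem (γ) := mem_orthogeodesics_iff h₁ h₂ (γ := γ)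
  choose! z hz0 hzγ hzΛ using fun γ hγ => (hmem γ).1 hγ
  have hlen {γ} (hγ : γ ∈ orthogeodesics K₁ σ₁ K₂ σ₂) : γ.length = ‖z γ‖ :=
    congrArg GeodesicCurve.length (hzγ γ hγ)
  set f : GeodesicCurve d → Euc d := fun γ => z γ + w (‖z γ‖⁻¹ • z γ) with hf
  have hinj : Set.InjOn f S := by
    intro γ hγ γ' hγ' h
    have hzz : z γ = z γ' := eq_of_add_radial_eq hL hw hr hLr
      (by rw [← hlen hγ.1]; exact hγ.2.1.le) (by rw [← hlen hγ'.1]; exact hγ'.2.1.le) h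
    rw [hzγ γ hγ.1, hzγ γ' hγ'.1]
    congr 1
  have hmaps : f '' S ⊆ latticeBall d (T + C) := by
    rintro _ ⟨γ, hγ, rfl⟩
    refine ⟨hzΛ γ hγ.1, (norm_add_le _ _).trans (add_le_add ?_ (hC _ ?_))⟩
    · rw [← hlen hγ.1]
      exact hγ.2.2
    · exact norm_normalize (hz0 γ hγ.1)
  -- Lattice points of norm at most `r + C` may be missed; their number does not depend on `T`.
  -- Beyond that radius the solution `v` satisfies `r < ‖v‖`, as membership in `S` requires.
  have hsurj : latticeBall d (T - C) ⊆ f '' S ∪ latticeBall d (r + C) := by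
    rintro y ⟨hy, hyT⟩
    rcases le_or_gt ‖y‖ (r + C) with hyr | hyr
    · exact Or.inr ⟨hy, hyr⟩
    obtain ⟨v, hvy, hv⟩ := exists_add_radial_eq hL hC hw hr hLr hC0 hyr.le
    have hv1 : r < ‖v‖ := by
      have := norm_sub_norm_le y v
      rw [norm_sub_rev] at this
      linarith
    have hv2 : ‖v‖ ≤ T := by
      have := norm_sub_norm_le v y
      linarith
    have hv0 : v ≠ 0 := norm_pos_iff.1 (hr.trans hv1)
    have hγ : radialCurve w₁ v hv0 ∈ orthogeodesics K₁ σ₁ K₂ σ₂ :=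
      (hmem _).2 ⟨v, hv0, rfl, hv.symm ▸ hy⟩
    refine Or.inl ⟨_, ⟨hγ, hv1, hv2⟩, ?_⟩
    have hzv : z (radialCurve w₁ v hv0) = v := (radialCurve_inj (hzγ _ hγ)).symm
    simp only [hf, hzv]
    exact hv
  have hfin : S.Finite := Set.Finite.of_finite_image ((finite_latticeBall d _).subset hmaps) hinj
  refine ⟨hfin, ?_, ?_⟩
  · rw [← hinj.ncard_image]
    exact (Set.ncard_le_ncard hsurj ((hfin.image f).union (finite_latticeBall d _))).trans
      (Set.ncard_union_le _ _)
  · rw [← hinj.ncard_image]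
    exact Set.ncard_le_ncard hmaps (finite_latticeBall d _)

lemma abs_add_pow_sub_pow_le {T a b : ℝ} (hab : |b| ≤ a) (haT : a ≤ T) (d : ℕ) :
    |(T + b) ^ d - T ^ d| ≤ a * d * 2 ^ (d - 1) * T ^ (d - 1) := by
  have ha : 0 ≤ a := (abs_nonneg b).trans hab
  refine (abs_pow_sub_pow_le _ _ _).trans ?_
  rw [add_sub_cancel_left, mul_assoc (a * d), ← mul_pow]
  have : max |T + b| |T| ≤ 2 * T := by
    have h1 := abs_add_le T b
    have h2 : |T| = T := abs_of_nonneg (ha.trans haT)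
    exact max_le (by linarith) (by linarith)
  gcongr

/-- A counting function that is sandwiched between lattice point counts in balls has the same
asymptotics as the volume of balls. -/
lemma isBigO_sub_of_latticeBall_bounds (hd : d ≠ 0) {N : ℝ → ℕ} {m : ℕ} {C T₀ : ℝ} (hC : 0 ≤ C)
    (hlow : ∀ T, T₀ < T → (latticeBall d (T - C)).ncard ≤ N T + m)
    (hup : ∀ T, T₀ < T → N T ≤ (latticeBall d (T + C)).ncard) :
    (fun T : ℝ => (N T : ℝ) - unitBallVolume d * T ^ d / (2 * Real.pi) ^ d) =O[Filter.atTop]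
      fun T : ℝ => T ^ (d - 1) := by
  set c := √(d * (2 * Real.pi) ^ 2) with hc
  have hc0 : 0 ≤ c := Real.sqrt_nonneg _
  set P := (2 * Real.pi) ^ d with hP
  have hP0 : 0 < P := by have := Real.two_pi_pos; positivity
  have hV := unitBallVolume_pos d
  set V := unitBallVolume d
  set a := C + c with ha
  have ha0 : 0 ≤ a := by positivity
  -- The first term comes from changing the radius by `a`, the sum of the perturbation bound and the
  -- cell diagonal. The second is the constant `m`, absorbed because `T ^ (d - 1) ≥ 1` for `T ≥ 1`.
  refine Asymptotics.IsBigO.of_bound (V * (a * d * 2 ^ (d - 1)) / P + m) ?_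
  filter_upwards [Filter.eventually_gt_atTop T₀, Filter.eventually_ge_atTop 1,
    Filter.eventually_ge_atTop a] with T hT hT1 hTa
  have hTp : 1 ≤ T ^ (d - 1) := one_le_pow₀ hT1
  rw [Real.norm_eq_abs, Real.norm_of_nonneg (by positivity)]
  have u1 : (N T : ℝ) * P ≤ V * (T + a) ^ d := by
    have h1 : (N T : ℝ) ≤ (latticeBall d (T + C)).ncard := by exact_mod_cast hup T hT
    have h2 := ncard_latticeBall_mul_le hd (R := T + C) (by linarith)
    rw [add_assoc, ← ha] at h2
    exact (mul_le_mul_of_nonneg_right h1 hP0.le).trans h2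
  have l1 : V * (T - a) ^ d ≤ ((N T : ℝ) + m) * P := by
    have h1 : ((latticeBall d (T - C)).ncard : ℝ) ≤ N T + m := by exact_mod_cast hlow T hT
    have h2 := le_ncard_latticeBall_mul hd (R := T - C) (by linarith)
    rw [sub_sub, ← ha] at h2
    exact h2.trans (mul_le_mul_of_nonneg_right h1 hP0.le)
  have u2 := le_of_abs_le (abs_add_pow_sub_pow_le (abs_of_nonneg ha0).le hTa d)
  have l2 := neg_le_of_abs_le
    (abs_add_pow_sub_pow_le (b := -a) (by rw [abs_neg, abs_of_nonneg ha0]) hTa d)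
  rw [← sub_eq_add_neg] at l2
  set D := a * d * 2 ^ (d - 1) * T ^ (d - 1) with hD
  have hm : (m : ℝ) ≤ m * T ^ (d - 1) := le_mul_of_one_le_right (Nat.cast_nonneg _) hTp
  have e : (V * (a * d * 2 ^ (d - 1)) / P + m) * T ^ (d - 1) = V * D / P + m * T ^ (d - 1) := by
    rw [hD]
    ring
  rw [e, abs_le]
  have u3 : (N T : ℝ) ≤ (V * T ^ d + V * D) / P := by
    rw [le_div_iff₀ hP0]
    nlinarith
  have l3 : (V * T ^ d - V * D) / P ≤ N T + m := by
    rw [div_le_iff₀ hP0]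
    nlinarith
  rw [add_div] at u3
  rw [sub_div] at l3
  have hm0 : (0 : ℝ) ≤ m := Nat.cast_nonneg _
  constructor <;> linarith

end OrthogeodesicCount

theorem proposition2p1 (d : ℕ) (hd : 2 ≤ d) (K₁ K₂ : Set (Euc d))
    (hK₁ : IsSmoothStrictlyConvex K₁) (hK₂ : IsSmoothStrictlyConvex K₂)
    (σ₁ σ₂ : NormalOrientation) :
    ∃ T₀ : ℝ, 0 < T₀ ∧
      (∀ T : ℝ, T₀ < T →
        {γ ∈ orthogeodesics K₁ σ₁ K₂ σ₂ | T₀ < γ.length ∧ γ.length ≤ T}.Finite) ∧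
      (fun T : ℝ =>
        (({γ ∈ orthogeodesics K₁ σ₁ K₂ σ₂ | T₀ < γ.length ∧ γ.length ≤ T}.ncard : ℕ) : ℝ) -
          Real.pi ^ ((d : ℝ) / 2) * T ^ d /
            ((2 * Real.pi) ^ d * Real.Gamma ((d : ℝ) / 2 + 1)))
        =O[Filter.atTop] (fun T : ℝ => T ^ (d - 1)) := by
  obtain ⟨w₁, L₁, C₁, hL₁, hC₁, h₁, hb₁, hl₁⟩ := hK₁.exists_directlyOrthogonal_iff hd σ₁
  obtain ⟨w₂, L₂, C₂, hL₂, hC₂, h₂, hb₂, hl₂⟩ := hK₂.exists_directlyOrthogonal_iff hd σ₂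
  -- The Lipschitz constant of `w₁ - w₂` is at most `L₁ + L₂`. Adding 1 keeps the threshold
  -- positive, as `L₁` and `L₂` are only known to be nonnegative.
  have hr : 0 < 4 * (L₁ + L₂) + 1 := by positivity
  have key := finite_and_ncard_orthogeodesics h₁ h₂ (L := L₁ + L₂) (C := C₁ + C₂)
    (r := 4 * (L₁ + L₂) + 1) (by positivity) (by positivity)
    (fun θ hθ => (norm_sub_le _ _).trans (add_le_add (hb₁ θ hθ) (hb₂ θ hθ)))
    (fun θ θ' hθ hθ' => by
      rw [sub_sub_sub_comm, add_mul]
      exact (norm_sub_le _ _).trans (add_le_add (hl₁ θ θ' hθ hθ') (hl₂ θ θ' hθ hθ')))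
    hr (by linarith)
  refine ⟨4 * (L₁ + L₂) + 1, hr, fun T _ => (key T).1, ?_⟩
  -- The bounds in `key` hold for every `T`, so any starting threshold would do; 0 is taken.
  have := isBigO_sub_of_latticeBall_bounds (by omega : d ≠ 0) (add_nonneg hC₁ hC₂)
    (T₀ := 0) (fun T _ => (key T).2.1) (fun T _ => (key T).2.2)
  refine this.congr_left fun T => ?_
  have hsqrt : √Real.pi ^ d = Real.pi ^ ((d : ℝ) / 2) := by
    rw [Real.sqrt_eq_rpow, ← Real.rpow_natCast, ← Real.rpow_mul Real.pi_pos.le]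
    ring_nf
  rw [unitBallVolume, hsqrt, mul_comm ((2 * Real.pi) ^ d), ← div_div, div_mul_eq_mul_div]
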